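/- Let $r\ge 2$. For $k\ge 1$ let $\mathcal P_{r,k}$ be the set of permutations $\pi$ of $\{1,\dots,rk+1\}$ such that $\sigma=\pi^{-1}$ is a $2134\cdots(r+1)$-cluster, i.e. for every $0\le j\le k-1$ the $r+1$ consecutive letters $\sigma_{rj+1}\sigma_{rj+2}\cdots\sigma_{rj+r+1}$ are in the same relative order as $2\,1\,3\,4\cdots(r+1)$. For a permutation $\pi=\pi_1\cdots\pi_n$ let $\mathrm{des}(\pi)$ be the number of $i$ with $1\le i\le n-1$ and $\pi_i>\pi_{i+1}$, let $\mathrm{pk}(\pi)$ be the number of $i$ with $2\le i\le n-1$ and $\pi_{i-1}<\pi_i>\pi_{i+1}$, and let $\mathrm{lpk}(\pi)$ be $\mathrm{pk}(\pi)$, plus $1$ if $n\ge 2$ and $\pi_1>\pi_2$. Put $$C_{r,k}(t,y)=\sum_{\pi\in\mathcal P_{r,k}}t^{\mathrm{des}(\pi)}y^{\mathrm{pk}(\pi)},\qquad \tilde C_{r,k}(t,y)=\sum_{\pi\in\mathcal P_{r,k}}t^{\mathrm{des}(\pi)}y^{\mathrm{lpk}(\pi)},$$ and consider the formal power series in $x$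 with coefficients in $\mathbb Q[t,y]$ $$F_r(t,y,x)=1+\sum_{k\ge 1}C_{r,k}(t,y)\frac{x^k}{k!},\qquad \tilde F_r(t,y,x)=1+\sum_{k\ge 1}\tilde C_{r,k}(t,y)\frac{x^k}{k!}.$$ A prime denotes the derivative with respect to $x$. Then, for every $r\ge 2$, $$\tilde F_r'=\bigl(t(y-1)+\tilde F_r(\tilde F_r-1+t)\bigr)\tilde F_r^{\,r-1},\qquad \tilde F_r(t,y,0)=1,$$ and $$F_r=\exp\Bigl(t(1-y)\int_0^x\tilde F_r(t,y,u)^{r-2}\,du\Bigr)\,\tilde F_r .$$ In particular, for $r=2$, $F_2=e^{t(1-y)x}\tilde F_2$, and $F_2$ satisfies $$F_2'=e^{t(y-1)x}\bigl(e^{t(y-1)x}F_2-1+t\bigr)F_2^{\,2},\qquad F_2(t,y,0)=1 .$$ -/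

import Mathlib

namespace InverseClusters

/-- The standardization of a word `w` with distinct letters: the letter `w a` is replaced by
its rank (`1` for the smallest letter, `2` for the second smallest, and so on). -/
def std {m n : ℕ} (w : Fin m → Fin n) (a : Fin m) : ℕ :=
  (Finset.univ.filter fun b : Fin m => w b ≤ w a).card

/-- The word `2 1 3 4 ⋯ m`. -/
def pattern (m : ℕ) (a : Fin m) : ℕ :=
  if a.val = 0 then 2 else if a.val = 1 then 1 else a.val + 1

theorem window_lt {r k : ℕ} (j : Fin k) (a : Fin (r + 1)) : r * j.val + a.val < r * k + 1 := by
  have h1 : r * (j.val + 1) ≤ r * k := Nat.mul_le_mul_left r j.isLt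
  have h2 := a.isLt
  rw [Nat.mul_add, Nat.mul_one] at h1
  omega

/-- The permutation `σ` of `rk + 1` letters is a `2134⋯(r+1)`-cluster: each of the `k` windows
of `r + 1` consecutive letters that start at the (zero-based) positions `r j`, for `j < k`,
has standardization `2134⋯(r+1)`. -/
def IsCluster (r k : ℕ) (σ : Equiv.Perm (Fin (r * k + 1))) : Prop :=
  ∀ j : Fin k,
    std (fun a : Fin (r + 1) => σ ⟨r * j.val + a.val, window_lt j a⟩) = pattern (r + 1)

instance (r k : ℕ) : DecidablePred (IsCluster r k) := fun σ => by
  unfold IsCluster; infer_instance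

/-- `P r k` is the set of the permutations of `rk + 1` letters whose inverse is a
`2134⋯(r+1)`-cluster. -/
def P (r k : ℕ) : Finset (Equiv.Perm (Fin (r * k + 1))) :=
  Finset.univ.filter fun π => IsCluster r k π⁻¹

/-- The position `i` (zero-based) is a descent of `π`. -/
def IsDescent {n : ℕ} (π : Equiv.Perm (Fin n)) (i : Fin n) : Prop :=
  ∃ h : i.val + 1 < n, π ⟨i.val + 1, h⟩ < π i

/-- The position `i` (zero-based) is a peak of `π`: it has neighbours on both sides, and its
letter is larger than both neighbouring letters. -/
def IsPeak {n : ℕ} (π : Equiv.Perm (Fin n)) (i : Fin n) : Prop :=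
  0 < i.val ∧ π ⟨i.val - 1, lt_of_le_of_lt (Nat.sub_le _ _) i.isLt⟩ < π i ∧ IsDescent π i

/-- The position `i` (zero-based) is a left peak of `π`: a peak, or an initial descent. -/
def IsLeftPeak {n : ℕ} (π : Equiv.Perm (Fin n)) (i : Fin n) : Prop :=
  IsPeak π i ∨ (i.val = 0 ∧ IsDescent π i)

instance {n : ℕ} (π : Equiv.Perm (Fin n)) : DecidablePred (IsDescent π) := fun i => by
  unfold IsDescent; infer_instance

instance {n : ℕ} (π : Equiv.Perm (Fin n)) : DecidablePred (IsPeak π) := fun i => by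
  unfold IsPeak; infer_instance

instance {n : ℕ} (π : Equiv.Perm (Fin n)) : DecidablePred (IsLeftPeak π) := fun i => by
  unfold IsLeftPeak; infer_instance

/-- The number of descents. -/
def des {n : ℕ} (π : Equiv.Perm (Fin n)) : ℕ := (Finset.univ.filter (IsDescent π)).card

/-- The number of peaks. -/
def pk {n : ℕ} (π : Equiv.Perm (Fin n)) : ℕ := (Finset.univ.filter (IsPeak π)).card

/-- The number of left peaks. -/
def lpk {n : ℕ} (π : Equiv.Perm (Fin n)) : ℕ := (Finset.univ.filter (IsLeftPeak π)).card

/-- The polynomial ring `ℚ[t, y]`. -/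
abbrev Poly : Type := MvPolynomial (Fin 2) ℚ

noncomputable section

/-- The variable `t`. -/
def t : Poly := MvPolynomial.X 0

/-- The variable `y`. -/
def y : Poly := MvPolynomial.X 1

/-- The polynomial `C_{r,k}(t, y)`. -/
def polyC (r k : ℕ) : Poly := ∑ π ∈ P r k, t ^ des π * y ^ pk π

/-- The polynomial `C̃_{r,k}(t, y)`. -/
def polyCtilde (r k : ℕ) : Poly := ∑ π ∈ P r k, t ^ des π * y ^ lpk π

/-- The formal power series `1 + ∑_{k ≥ 1} a_k x^k / k!` in `x` over `ℚ[t, y]`. -/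
def egf (a : ℕ → Poly) : PowerSeries Poly :=
  PowerSeries.mk fun k => if k = 0 then 1 else (1 / (k.factorial : ℚ)) • a k

/-- The series `F_r(t, y, x)`. -/
def F (r : ℕ) : PowerSeries Poly := egf (polyC r)

/-- The series `F̃_r(t, y, x)`. -/
def Ftilde (r : ℕ) : PowerSeries Poly := egf (polyCtilde r)

/-- The formal antiderivative `∫_0^x f(u) du`, without constant term. -/
def integral (f : PowerSeries Poly) : PowerSeries Poly :=
  PowerSeries.mk fun n => if n = 0 then 0 else (1 / (n : ℚ)) • PowerSeries.coeff (n - 1) f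

/-- The series `e^g = ∑_n g^n / n!`, for a series `g` in `x` without constant term. -/
def expOf (g : PowerSeries Poly) : PowerSeries Poly :=
  PowerSeries.subst g (PowerSeries.exp Poly)

end

end InverseClusters

/-!
The proof has a combinatorial half, which yields a linear partial differential equation for each of
the two generating functions, and an algebraic half, which deduces the claims from these equations.

*Combinatorics.* The windows of a cluster `σ` say (with positions counted from zero) that
`σ (rj + 1) < σ (rj) < σ (rj + 2) < ⋯ < σ (rj + r)`. Hence the last window forces the `r - 1`
largest values to stand at the last `r - 1` positions, and every `π` in `P r (k + 1)` arises in
exactly one way from a member of `P r k` by inserting the new maximal letter `rk + 1` at one of the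
`rk + 1` places in front of the last letter and appending an increasing run (`sum_natP_succ`). If
the permutations are extended to `ℕ` by the identity, then the run need not be mentioned, and the
insertion is the multiplication by a cycle. An insertion into an ascent creates a descent; it
creates a peak and destroys the peak at either end of the gap, if there is one. Adding up over all
gaps (`sum_wt_insertAt`), a word with `d` descents and `p` peaks contributes
`t^d y^p (t y (rk - d) + y d + p (1 + t) (1 - y) + c)`, where `c`, which is `t y` for left peaks and
`t` for peaks, comes from the gap in front. With the derivation `D` of `ℚ[t, y]` that has
`D t = t y (1 - t)` and `D y = (1 + t) y (1 - y)`, this means that the generating functions satisfy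
`M F̃ = t y F̃` and `M F = t F` for the derivation `M = (1 - r t y x) ∂ₓ - D`
(`pdeOp_Ftilde`, `pdeOp_F`).

*Algebra.* A solution of `M E = c E` without constant term vanishes (`eq_zero_of_pdeOp_eq`).
Let `Φ(u) = (t (y - 1) + u (u - 1 + t)) u^(r - 1)`. The commutation rule `∂ₓ M = (M - r t y) ∂ₓ`
and the Leibniz rule show that both `F̃'` and `Φ(F̃)` are solutions of `M E = (r + 1) t y E`, and
their constant terms agree, so they are equal (`derivative_eq_of_pdeOp_eq`). Likewise
`A = t (1 - y) ∫ F̃^(r - 2)` has `M A = t (1 - y)`, so `F` and `e^A F̃` are both solutions of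
`M E = t E` with constant term `1` (`eq_expOf_mul_of_pdeOp_eq`).
-/

namespace InverseClusters

/-! ### Descents and peaks of a word under the insertion of a new maximal letter -/

open Classical in
/-- The indicator of the descent `f p > f (p + 1)`. -/
noncomputable def descInd (f : ℕ → ℕ) (p : ℕ) : ℕ := if f (p + 1) < f p then 1 else 0

open Classical in
/-- The indicator of a peak of `f` at `p`. The proposition `b` tells whether an initial descent
counts as a peak: it does for left peaks, and it does not for peaks. -/
noncomputable def peakInd (b : Prop) (f : ℕ → ℕ) (p : ℕ) : ℕ :=
  if (f (p + 1) < f p ∧ ((p = 0 ∧ b) ∨ (0 < p ∧ f (p - 1) < f p))) then 1 else 0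

/-- The word `f` with the letter `m` inserted at the position `i`. -/
def insertAt (i m : ℕ) (f : ℕ → ℕ) (p : ℕ) : ℕ :=
  if p < i then f p else if p = i then m else f (p - 1)

theorem insertAt_of_lt {i m : ℕ} {f : ℕ → ℕ} {p : ℕ} (h : p < i) : insertAt i m f p = f p :=
  if_pos h

theorem insertAt_self {i m : ℕ} {f : ℕ → ℕ} : insertAt i m f i = m := by
  simp [insertAt]

theorem insertAt_of_gt {i m : ℕ} {f : ℕ → ℕ} {p : ℕ} (h : i < p) :
    insertAt i m f p = f (p - 1) := by
  rw [insertAt, if_neg (by omega), if_neg (by omega)]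

theorem peakInd_eq_zero_of_descInd {b : Prop} {f : ℕ → ℕ} {p : ℕ} (h : descInd f p = 0) :
    peakInd b f p = 0 := by
  unfold descInd at h
  unfold peakInd
  rw [if_neg]
  rintro ⟨h1, -⟩
  simp [h1] at h

/-- Inserting a large letter into the gap between the positions `j` and `j + 1` creates a descent,
unless there was one in this gap. -/
theorem sum_descInd_insertAt_succ {N m : ℕ} {f : ℕ → ℕ} (hm : ∀ p ≤ N, f p < m) {j : ℕ}
    (hj : j < N) :
    ∑ p ∈ Finset.range (N + 1), descInd (insertAt (j + 1) m f) p + descInd f j =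
      ∑ p ∈ Finset.range N, descInd f p + 1 := by
  obtain ⟨l, rfl⟩ : ∃ l, N = j + 1 + l := ⟨N - (j + 1), by omega⟩
  rw [show j + 1 + l + 1 = j + 2 + l by ring, Finset.sum_range_add _ (j + 2) l,
    Finset.sum_range_add _ (j + 1) l,
    Finset.sum_range_succ, Finset.sum_range_succ, Finset.sum_range_succ]
  have h1 : ∀ p ∈ Finset.range j, descInd (insertAt (j + 1) m f) p = descInd f p := by
    intro p hp
    have := Finset.mem_range.1 hp
    rw [descInd, descInd, insertAt_of_lt (by omega), insertAt_of_lt (by omega)]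
  have h2 : descInd (insertAt (j + 1) m f) j = 0 := by
    have := hm j (by omega)
    rw [descInd, insertAt_self, insertAt_of_lt (by omega), if_neg (by omega)]
  have h3 : descInd (insertAt (j + 1) m f) (j + 1) = 1 := by
    rw [descInd, insertAt_self, insertAt_of_gt (by omega), if_pos (hm _ (by omega))]
  have h4 : ∀ p ∈ Finset.range l,
      descInd (insertAt (j + 1) m f) (j + 2 + p) = descInd f (j + 1 + p) := by
    intro p _
    rw [descInd, descInd, insertAt_of_gt (by omega), insertAt_of_gt (by omega),
      show j + 2 + p + 1 - 1 = j + 1 + p + 1 by omega, show j + 2 + p - 1 = j + 1 + p by omega]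
  rw [Finset.sum_congr rfl h1, Finset.sum_congr rfl h4, h2, h3]
  ring

/-- Inserting a large letter into the gap between the positions `j` and `j + 1` creates a peak, and
destroys a peak at either end of the gap. -/
theorem sum_peakInd_insertAt_succ (b : Prop) {N m : ℕ} {f : ℕ → ℕ} (hm : ∀ p ≤ N, f p < m)
    (hN : descInd f N = 0) {j : ℕ} (hj : j < N) :
    ∑ p ∈ Finset.range (N + 1), peakInd b (insertAt (j + 1) m f) p + peakInd b f j +
        peakInd b f (j + 1) =
      ∑ p ∈ Finset.range N, peakInd b f p + 1 := by
  obtain ⟨l, rfl⟩ : ∃ l, N = j + 1 + l := ⟨N - (j + 1), by omega⟩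
  rw [show j + 1 + l + 1 = j + 2 + l by ring, Finset.sum_range_add _ (j + 2) l,
    Finset.sum_range_add _ (j + 1) l,
    Finset.sum_range_succ, Finset.sum_range_succ, Finset.sum_range_succ]
  have h1 : ∀ p ∈ Finset.range j, peakInd b (insertAt (j + 1) m f) p = peakInd b f p := by
    intro p hp
    have := Finset.mem_range.1 hp
    rw [peakInd, peakInd, insertAt_of_lt (by omega), insertAt_of_lt (by omega),
      insertAt_of_lt (by omega)]
  have h2 : peakInd b (insertAt (j + 1) m f) j = 0 := by
    apply peakInd_eq_zero_of_descInd
    have := hm j (by omega)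
    rw [descInd, insertAt_self, insertAt_of_lt (by omega), if_neg (by omega)]
  have h3 : peakInd b (insertAt (j + 1) m f) (j + 1) = 1 := by
    rw [peakInd, insertAt_self, insertAt_of_gt (by omega), insertAt_of_lt (by omega), if_pos]
    exact ⟨hm _ (by omega), Or.inr ⟨by omega, hm _ (by omega)⟩⟩
  -- the first position after the new letter is no longer a peak
  have h4 : ∑ p ∈ Finset.range l, peakInd b (insertAt (j + 1) m f) (j + 2 + p) +
      peakInd b f (j + 1) = ∑ p ∈ Finset.range l, peakInd b f (j + 1 + p) := by
    cases l with
    | zero => simpa using peakInd_eq_zero_of_descInd hN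
    | succ l =>
      rw [Finset.sum_range_succ', Finset.sum_range_succ']
      have h5 : peakInd b (insertAt (j + 1) m f) (j + 2 + 0) = 0 := by
        rw [peakInd, if_neg]
        rintro ⟨-, ⟨h, -⟩ | ⟨-, h⟩⟩
        · omega
        · rw [show j + 2 + 0 - 1 = j + 1 by omega, insertAt_self, insertAt_of_gt (by omega)] at h
          have := hm (j + 2 + 0 - 1) (by omega)
          omega
      rw [h5, add_zero, add_zero, add_left_inj]
      refine Finset.sum_congr rfl fun p _ => ?_
      rw [peakInd, peakInd, insertAt_of_gt (by omega), insertAt_of_gt (by omega),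
        insertAt_of_gt (by omega), show j + 2 + (p + 1) + 1 - 1 = j + 1 + (p + 1) + 1 by omega,
        show j + 2 + (p + 1) - 1 = j + 1 + (p + 1) by omega]
      simp
  rw [Finset.sum_congr rfl h1, h2, h3, ← h4]
  ring

theorem sum_descInd_insertAt_zero {N m : ℕ} {f : ℕ → ℕ} (hm : ∀ p ≤ N, f p < m) :
    ∑ p ∈ Finset.range (N + 1), descInd (insertAt 0 m f) p =
      ∑ p ∈ Finset.range N, descInd f p + 1 := by
  rw [Finset.sum_range_succ']
  congr 1
  rw [descInd, insertAt_self, insertAt_of_gt (by omega), if_pos (hm _ (by omega))]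

open Classical in
theorem sum_peakInd_insertAt_zero (b : Prop) {N m : ℕ} {f : ℕ → ℕ} (hm : ∀ p ≤ N, f p < m)
    (hN : descInd f N = 0) :
    ∑ p ∈ Finset.range (N + 1), peakInd b (insertAt 0 m f) p + peakInd b f 0 =
      ∑ p ∈ Finset.range N, peakInd b f p + if b then 1 else 0 := by
  rw [Finset.sum_range_succ', add_right_comm]
  congr 1
  · cases N with
    | zero => simpa using peakInd_eq_zero_of_descInd hN
    | succ N =>
      rw [Finset.sum_range_succ', Finset.sum_range_succ' (fun p => peakInd b f p)]
      have h5 : peakInd b (insertAt 0 m f) (0 + 1) = 0 := by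
        rw [peakInd, if_neg]
        rintro ⟨-, ⟨h, -⟩ | ⟨-, h⟩⟩
        · omega
        · rw [Nat.add_sub_cancel, insertAt_self, insertAt_of_gt (by omega)] at h
          have := hm (0 + 1 - 1) (by omega)
          omega
      rw [h5, add_zero, add_left_inj]
      refine Finset.sum_congr rfl fun p _ => ?_
      rw [peakInd, peakInd, insertAt_of_gt (by omega), insertAt_of_gt (by omega),
        insertAt_of_gt (by omega)]
      simp
  · rw [peakInd, insertAt_self, insertAt_of_gt (by omega)]
    have := hm 0 (by omega)
    simp [this]

theorem descInd_eq_zero_or_one (f : ℕ → ℕ) (p : ℕ) : descInd f p = 0 ∨ descInd f p = 1 := by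
  unfold descInd
  split_ifs <;> simp

theorem peakInd_eq_zero_or_one (b : Prop) (f : ℕ → ℕ) (p : ℕ) :
    peakInd b f p = 0 ∨ peakInd b f p = 1 := by
  unfold peakInd
  split_ifs <;> simp

/-- A peak at `p + 1` is preceded by an ascent. -/
theorem descInd_eq_zero_of_peakInd_succ {b : Prop} {f : ℕ → ℕ} {p : ℕ}
    (h : peakInd b f (p + 1) = 1) : descInd f p = 0 := by
  unfold peakInd at h
  unfold descInd
  rw [if_neg]
  intro h'
  rw [if_neg] at h
  · omega
  · rintro ⟨-, ⟨h, -⟩ | ⟨-, h⟩⟩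
    · omega
    · rw [Nat.add_sub_cancel] at h; omega

/-- The monomial `t^des y^pk` of the first `N + 1` letters of `f`. -/
noncomputable def wt (b : Prop) (N : ℕ) (f : ℕ → ℕ) : Poly :=
  t ^ (∑ p ∈ Finset.range N, descInd f p) * y ^ (∑ p ∈ Finset.range N, peakInd b f p)

/-- The contribution of one interior gap: the new letter lies in an ascent or a descent, and at most
one end of the gap is a peak. -/
theorem wt_insertAt_succ (b : Prop) {N m : ℕ} {f : ℕ → ℕ} (hm : ∀ p ≤ N, f p < m)
    (hN : descInd f N = 0) {j : ℕ} (hj : j < N) :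
    wt b (N + 1) (insertAt (j + 1) m f) =
      wt b N f * (t * y + descInd f j * (y - t * y) + peakInd b f j * (1 - y) +
        peakInd b f (j + 1) * (t - t * y)) := by
  have hd := sum_descInd_insertAt_succ hm hj
  have hp := sum_peakInd_insertAt_succ b hm hN hj
  unfold wt
  generalize ∑ p ∈ Finset.range (N + 1), descInd (insertAt (j + 1) m f) p = d' at *
  generalize ∑ p ∈ Finset.range (N + 1), peakInd b (insertAt (j + 1) m f) p = p' at *
  generalize ∑ p ∈ Finset.range N, descInd f p = d at *
  generalize ∑ p ∈ Finset.range N, peakInd b f p = p at *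
  rcases descInd_eq_zero_or_one f j with h | h
  · rw [peakInd_eq_zero_of_descInd h] at hp ⊢
    rw [h] at hd ⊢
    obtain rfl : d' = d + 1 := by omega
    rcases peakInd_eq_zero_or_one b f (j + 1) with h' | h' <;> rw [h'] at hp ⊢
    · obtain rfl : p' = p + 1 := by omega
      push_cast; ring
    · obtain rfl : p' = p := by omega
      push_cast; ring
  · have h'' : peakInd b f (j + 1) = 0 := by
      rcases peakInd_eq_zero_or_one b f (j + 1) with h' | h'
      · exact h'
      · rw [descInd_eq_zero_of_peakInd_succ h'] at h; omega
    rw [h''] at hp ⊢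
    rw [h] at hd ⊢
    obtain rfl : d' = d := by omega
    rcases peakInd_eq_zero_or_one b f j with h' | h' <;> rw [h'] at hp ⊢
    · obtain rfl : p' = p + 1 := by omega
      push_cast; ring
    · obtain rfl : p' = p := by omega
      push_cast; ring

open Classical in
/-- The contribution of the gap in front of the word. -/
theorem wt_insertAt_zero (b : Prop) {N m : ℕ} {f : ℕ → ℕ} (hm : ∀ p ≤ N, f p < m)
    (hN : descInd f N = 0) :
    wt b (N + 1) (insertAt 0 m f) =
      wt b N f * ((if b then t * y else t) + peakInd b f 0 * (t - t * y)) := by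
  have hd := sum_descInd_insertAt_zero hm
  have hp := sum_peakInd_insertAt_zero b hm hN
  have h0 : ¬ b → peakInd b f 0 = 0 := fun hb => by simp [peakInd, hb]
  unfold wt
  rw [hd]
  generalize ∑ p ∈ Finset.range (N + 1), peakInd b (insertAt 0 m f) p = p' at *
  generalize ∑ p ∈ Finset.range N, descInd f p = d at *
  generalize ∑ p ∈ Finset.range N, peakInd b f p = p at *
  by_cases hb : b
  · rw [if_pos hb] at hp ⊢
    rcases peakInd_eq_zero_or_one b f 0 with h' | h' <;> rw [h'] at hp ⊢
    · obtain rfl : p' = p + 1 := by omega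
      push_cast; ring
    · obtain rfl : p' = p := by omega
      push_cast; ring
  · rw [if_neg hb] at hp ⊢
    rw [h0 hb] at hp ⊢
    obtain rfl : p' = p := by omega
    push_cast; ring

open Classical in
/-- The contributions of all gaps of a word with `N + 1` letters, except the one at its end. -/
theorem sum_wt_insertAt (b : Prop) {N m : ℕ} {f : ℕ → ℕ} (hm : ∀ p ≤ N, f p < m)
    (hN : descInd f N = 0) :
    ∑ i ∈ Finset.range (N + 1), wt b (N + 1) (insertAt i m f) =
      wt b N f * ((∑ p ∈ Finset.range N, descInd f p : ℕ) * (y * (1 - t)) +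
          (∑ p ∈ Finset.range N, peakInd b f p : ℕ) * ((1 + t) * (1 - y))) +
        ((if b then t * y else t) + N * t * y) * wt b N f := by
  rw [Finset.sum_range_succ', wt_insertAt_zero b hm hN]
  rw [Finset.sum_congr rfl fun j hj => wt_insertAt_succ b hm hN (Finset.mem_range.1 hj)]
  rw [← Finset.mul_sum, Finset.sum_add_distrib, Finset.sum_add_distrib, Finset.sum_add_distrib,
    Finset.sum_const, Finset.card_range, nsmul_eq_mul, ← Finset.sum_mul, ← Finset.sum_mul,
    ← Finset.sum_mul]
  have h : (∑ j ∈ Finset.range N, (peakInd b f (j + 1) : Poly)) + peakInd b f 0 =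
      ∑ j ∈ Finset.range N, (peakInd b f j : Poly) := by
    have h1 := Finset.sum_range_succ' (fun j => (peakInd b f j : Poly)) N
    rw [Finset.sum_range_succ, peakInd_eq_zero_of_descInd hN, Nat.cast_zero, add_zero] at h1
    exact h1.symm
  push_cast
  rw [← h]
  ring

/-! ### Derivations of power series over `ℚ[t, y]` -/

noncomputable section

open PowerSeries (coeff constantCoeff derivative)

/-- The derivation `D` of `ℚ[t, y]` with `D t = t y (1 - t)` and `D y = (1 + t) y (1 - y)`. -/
def polyDeriv : Derivation ℚ Poly Poly :=
  MvPolynomial.mkDerivation ℚ ![t * y * (1 - t), (1 + t) * y * (1 - y)]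

theorem polyDeriv_t : polyDeriv t = t * y * (1 - t) := by
  simp [polyDeriv, t, MvPolynomial.mkDerivation_X]

theorem polyDeriv_y : polyDeriv y = (1 + t) * y * (1 - y) := by
  simp [polyDeriv, y, MvPolynomial.mkDerivation_X]

theorem polyDeriv_monomial (d p : ℕ) :
    polyDeriv (t ^ d * y ^ p) =
      t ^ d * y ^ p * (d * (y * (1 - t)) + p * ((1 + t) * (1 - y))) := by
  have ht : polyDeriv (t ^ d) = t ^ d * (d * (y * (1 - t))) := by
    rw [Derivation.leibniz_pow, polyDeriv_t]
    cases d <;> simp [pow_succ]; ring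
  have hy : polyDeriv (y ^ p) = y ^ p * (p * ((1 + t) * (1 - y))) := by
    rw [Derivation.leibniz_pow, polyDeriv_y]
    cases p <;> simp [pow_succ]; ring
  rw [Derivation.leibniz, ht, hy, smul_eq_mul, smul_eq_mul]
  ring

/-- The derivation `polyDeriv`, applied to every coefficient of a power series. -/
def coeffDeriv : Derivation ℚ (PowerSeries Poly) (PowerSeries Poly) :=
  Derivation.mk'
    { toFun := fun f => PowerSeries.mk fun n => polyDeriv (coeff n f)
      map_add' := fun f g => by ext1 n; simp
      map_smul' := fun c f => by ext1 n; simp }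
    (fun f g => by
      ext1 n
      simp only [LinearMap.coe_mk, AddHom.coe_mk, PowerSeries.coeff_mk, smul_eq_mul, map_add,
        PowerSeries.coeff_mul, map_sum, Derivation.leibniz]
      rw [Finset.sum_add_distrib, add_right_inj]
      exact Finset.Nat.sum_antidiagonal_swap
        (f := fun p => coeff p.1 g * polyDeriv (coeff p.2 f)))

theorem coeff_coeffDeriv (f : PowerSeries Poly) (n : ℕ) :
    coeff n (coeffDeriv f) = polyDeriv (coeff n f) := by
  simp [coeffDeriv]

theorem coeffDeriv_C (c : Poly) :
    coeffDeriv (PowerSeries.C c) = PowerSeries.C (polyDeriv c) := by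
  ext1 n
  rw [coeff_coeffDeriv, PowerSeries.coeff_C, PowerSeries.coeff_C]
  split_ifs <;> simp

theorem derivative_coeffDeriv (f : PowerSeries Poly) :
    derivative Poly (coeffDeriv f) = coeffDeriv (derivative Poly f) := by
  ext1 n
  rw [PowerSeries.coeff_derivative, coeff_coeffDeriv, coeff_coeffDeriv,
    PowerSeries.coeff_derivative, Derivation.leibniz]
  have : polyDeriv ((n : Poly) + 1) = 0 := by
    rw [map_add, Derivation.map_natCast, Derivation.map_one_eq_zero, add_zero]
  rw [this, smul_zero, zero_add, smul_eq_mul, mul_comm]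

/-- The derivation `M = (1 - r t y x) ∂ₓ - D`, with `D` acting on the coefficients. -/
def pdeOp (r : ℕ) : Derivation ℚ (PowerSeries Poly) (PowerSeries Poly) :=
  (1 - PowerSeries.C (r * t * y) * PowerSeries.X : PowerSeries Poly) •
    (derivative Poly).restrictScalars ℚ - coeffDeriv

theorem pdeOp_apply (r : ℕ) (f : PowerSeries Poly) :
    pdeOp r f = (1 - PowerSeries.C (r * t * y) * PowerSeries.X) * derivative Poly f -
      coeffDeriv f := rfl

theorem pdeOp_C (r : ℕ) (c : Poly) :
    pdeOp r (PowerSeries.C c) = -PowerSeries.C (polyDeriv c) := by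
  rw [pdeOp_apply, PowerSeries.derivative_C, coeffDeriv_C, mul_zero, zero_sub]

theorem constantCoeff_pdeOp (r : ℕ) (f : PowerSeries Poly) :
    constantCoeff (pdeOp r f) = constantCoeff (derivative Poly f) -
      polyDeriv (constantCoeff f) := by
  rw [pdeOp_apply]
  simp only [map_sub, map_mul, map_one, PowerSeries.constantCoeff_X, mul_zero, sub_zero, one_mul]
  rw [← PowerSeries.coeff_zero_eq_constantCoeff_apply (coeffDeriv f), coeff_coeffDeriv,
    PowerSeries.coeff_zero_eq_constantCoeff_apply]

/-- The operator `M` commutes with `∂ₓ` up to the term that comes from its coefficient in `x`. -/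
theorem derivative_pdeOp (r : ℕ) (f : PowerSeries Poly) :
    derivative Poly (pdeOp r f) =
      pdeOp r (derivative Poly f) - PowerSeries.C (r * t * y) * derivative Poly f := by
  rw [pdeOp_apply, pdeOp_apply, map_sub, derivative_coeffDeriv, Derivation.leibniz, map_sub,
    Derivation.leibniz, PowerSeries.derivative_C, PowerSeries.derivative_X,
    Derivation.map_one_eq_zero]
  simp only [smul_eq_mul]
  ring

theorem coeff_pdeOp (r : ℕ) (f : PowerSeries Poly) (n : ℕ) :
    coeff n (pdeOp r f) = coeff (n + 1) f * (n + 1) - r * t * y * (n * coeff n f) -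
      polyDeriv (coeff n f) := by
  rw [pdeOp_apply, map_sub, coeff_coeffDeriv, sub_mul, one_mul, map_sub,
    PowerSeries.coeff_derivative, mul_assoc, PowerSeries.coeff_C_mul]
  congr 2
  cases n with
  | zero => simp
  | succ n =>
    rw [PowerSeries.coeff_succ_X_mul, PowerSeries.coeff_derivative]
    push_cast
    ring

/-- A solution of `M E = c E` is determined by its constant term, because the equation expresses
each coefficient through the preceding one. -/
theorem eq_zero_of_pdeOp_eq (r : ℕ) (c : Poly) (E : PowerSeries Poly)
    (hE : pdeOp r E = PowerSeries.C c * E) (h0 : constantCoeff E = 0) : E = 0 := by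
  ext1 n
  rw [map_zero]
  induction n with
  | zero => rwa [PowerSeries.coeff_zero_eq_constantCoeff_apply]
  | succ n ih =>
    have h := congrArg (coeff n) hE
    rw [coeff_pdeOp, PowerSeries.coeff_C_mul, ih] at h
    simp only [mul_zero, map_zero, sub_zero, mul_eq_zero] at h
    exact h.resolve_right (Nat.cast_add_one_ne_zero n)

theorem eq_zero_of_derivative_eq_mul (g E : PowerSeries Poly)
    (hE : derivative Poly E = g * E) (h0 : constantCoeff E = 0) : E = 0 := by
  ext1 n
  rw [map_zero]
  induction n using Nat.strong_induction_on with
  | _ n ih =>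
    cases n with
    | zero => rwa [PowerSeries.coeff_zero_eq_constantCoeff_apply]
    | succ n =>
      have h := congrArg (coeff n) hE
      rw [PowerSeries.coeff_derivative, PowerSeries.coeff_mul, Finset.sum_eq_zero] at h
      · exact (mul_eq_zero.1 h).resolve_right (Nat.cast_add_one_ne_zero n)
      · intro p hp
        rw [ih p.2 (by have := Finset.HasAntidiagonal.mem_antidiagonal.1 hp; omega), mul_zero]

/-! ### Exponentials -/

theorem derivative_expOf (g : PowerSeries Poly) (hg : constantCoeff g = 0) :
    derivative Poly (expOf g) = expOf g * derivative Poly g := by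
  rw [expOf, PowerSeries.derivative_subst (PowerSeries.HasSubst.of_constantCoeff_zero hg),
    PowerSeries.derivative_exp]

theorem constantCoeff_expOf (g : PowerSeries Poly) (hg : constantCoeff g = 0) :
    constantCoeff (expOf g) = 1 := by
  have hs := PowerSeries.HasSubst.of_constantCoeff_zero hg
  have h1 : PowerSeries.exp Poly = 1 + (PowerSeries.exp Poly - 1) := by ring
  have h2 := PowerSeries.constantCoeff_subst_eq_zero hg (PowerSeries.exp Poly - 1) (by simp)
  have h3 : PowerSeries.subst g (1 : PowerSeries Poly) = (1 : PowerSeries Poly) := by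
    rw [← PowerSeries.coe_substAlgHom hs, map_one]
  rw [expOf, h1, PowerSeries.subst_add hs, map_add, h3, map_one]
  exact (congrArg (1 + ·) h2).trans (add_zero 1)

theorem expOf_mul_expOf_neg (g : PowerSeries Poly) (hg : constantCoeff g = 0) :
    expOf g * expOf (-g) = 1 := by
  have hg' : constantCoeff (-g) = 0 := by rw [map_neg, hg, neg_zero]
  apply PowerSeries.derivative.ext
  · rw [Derivation.leibniz, derivative_expOf g hg, derivative_expOf _ hg',
      Derivation.map_one_eq_zero, map_neg]
    simp only [smul_eq_mul]
    ring
  · rw [map_mul, constantCoeff_expOf g hg, constantCoeff_expOf _ hg', mul_one, map_one]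

theorem derivative_integral (f : PowerSeries Poly) : derivative Poly (integral f) = f := by
  ext1 n
  rw [PowerSeries.coeff_derivative, integral, PowerSeries.coeff_mk, if_neg n.succ_ne_zero,
    Nat.add_sub_cancel, smul_mul_assoc]
  have h : (coeff n f : Poly) * ((n : Poly) + 1) = ((n + 1 : ℕ) : ℚ) • coeff n f := by
    rw [Nat.cast_smul_eq_nsmul, nsmul_eq_mul, mul_comm]; push_cast; rfl
  rw [h, smul_smul, one_div_mul_cancel (by positivity), one_smul]

theorem constantCoeff_integral (f : PowerSeries Poly) : constantCoeff (integral f) = 0 := by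
  rw [← PowerSeries.coeff_zero_eq_constantCoeff_apply, integral, PowerSeries.coeff_mk, if_pos rfl]

theorem integral_one : integral 1 = PowerSeries.X := by
  apply PowerSeries.derivative.ext
  · rw [derivative_integral, PowerSeries.derivative_X]
  · rw [constantCoeff_integral, PowerSeries.constantCoeff_X]

/-- If `M A` is a constant `a`, then `M (e^A) = a e^A`: the difference `W` of the two sides
satisfies `W' = A' W` and has no constant term. -/
theorem pdeOp_expOf (r : ℕ) (a : Poly) (A : PowerSeries Poly) (hA : constantCoeff A = 0)
    (hM : pdeOp r A = PowerSeries.C a) :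
    pdeOp r (expOf A) = PowerSeries.C a * expOf A := by
  rw [← sub_eq_zero]
  apply eq_zero_of_derivative_eq_mul (derivative Poly A)
  · have h1 : pdeOp r (derivative Poly A) = PowerSeries.C (r * t * y) * derivative Poly A := by
      have := derivative_pdeOp r A
      rw [hM, PowerSeries.derivative_C] at this
      exact (sub_eq_zero.1 this.symm)
    rw [map_sub, derivative_pdeOp, derivative_expOf A hA, Derivation.leibniz, Derivation.leibniz,
      h1, derivative_expOf A hA, PowerSeries.derivative_C]
    simp only [smul_eq_mul]
    ring
  · have h2 := congrArg constantCoeff hM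
    rw [constantCoeff_pdeOp, hA, map_zero, sub_zero, PowerSeries.constantCoeff_C] at h2
    rw [map_sub, constantCoeff_pdeOp, derivative_expOf A hA, map_mul, map_mul, h2,
      constantCoeff_expOf A hA, PowerSeries.constantCoeff_C, Derivation.map_one_eq_zero]
    ring

/-! ### From the partial differential equation to the ordinary one -/

/-- A recurrence for the coefficients turns into an equation for the generating function. -/
theorem pdeOp_egf (r : ℕ) (c : Poly) (a : ℕ → Poly) (h0 : a 0 = 1)
    (ha : ∀ k, a (k + 1) = polyDeriv (a k) + (c + r * t * y * k) * a k) :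
    pdeOp r (egf a) = PowerSeries.C c * egf a := by
  have hcoeff : ∀ k, coeff k (egf a) = (1 / (k.factorial : ℚ)) • a k := by
    intro k
    rw [egf, PowerSeries.coeff_mk]
    split_ifs with hk
    · subst hk; simp [h0]
    · rfl
  ext1 n
  have hn : (1 / ((n + 1).factorial : ℚ)) • a (n + 1) * ((n : Poly) + 1) =
      (1 / (n.factorial : ℚ)) • a (n + 1) := by
    have h : a (n + 1) * ((n : Poly) + 1) = ((n + 1 : ℕ) : ℚ) • a (n + 1) := by
      rw [Nat.cast_smul_eq_nsmul, nsmul_eq_mul, mul_comm]; push_cast; rfl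
    rw [smul_mul_assoc, h, smul_smul, Nat.factorial_succ]
    congr 1
    have : (n.factorial : ℚ) ≠ 0 := by positivity
    push_cast
    field_simp
  rw [coeff_pdeOp, PowerSeries.coeff_C_mul, hcoeff, hcoeff, hn, ha, Derivation.map_smul]
  simp only [Algebra.smul_def]
  ring

theorem constantCoeff_egf (a : ℕ → Poly) : constantCoeff (egf a) = 1 := by
  rw [← PowerSeries.coeff_zero_eq_constantCoeff_apply, egf, PowerSeries.coeff_mk, if_pos rfl]

/-- The differential equation for a series `G` with `G(0) = 1` and `M G = t y G`. The defect of the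
equation is annihilated by `M - (r + 1) t y` and has no constant term. -/
theorem derivative_eq_of_pdeOp_eq (r : ℕ) (hr : 2 ≤ r) (G : PowerSeries Poly)
    (hG : pdeOp r G = PowerSeries.C (t * y) * G) (h0 : constantCoeff G = 1) :
    derivative Poly G =
      (PowerSeries.C (t * (y - 1)) + G * (G - 1 + PowerSeries.C t)) * G ^ (r - 1) := by
  obtain ⟨s, rfl⟩ : ∃ s, r = s + 2 := ⟨r - 2, by omega⟩
  rw [show s + 2 - 1 = s + 1 from rfl, ← sub_eq_zero]
  apply eq_zero_of_pdeOp_eq (s + 2) ((s + 3 : ℕ) * t * y)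
  · have h1 : pdeOp (s + 2) (derivative Poly G) =
        PowerSeries.C ((s + 3 : ℕ) * t * y) * derivative Poly G := by
      have := derivative_pdeOp (s + 2) G
      rw [hG, Derivation.leibniz, PowerSeries.derivative_C, smul_zero, add_zero, smul_eq_mul,
        eq_sub_iff_add_eq] at this
      rw [← this, ← add_mul, ← map_add]
      congr 2
      push_cast
      ring
    rw [map_sub, h1, mul_sub]
    simp only [Derivation.leibniz, map_add, map_sub, Derivation.leibniz_pow, hG, pdeOp_C,
      polyDeriv_t, polyDeriv_y, Derivation.map_one_eq_zero, smul_eq_mul, map_mul, map_one,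
      map_natCast, nsmul_eq_mul, Nat.add_sub_cancel]
    push_cast
    ring
  · have h1 := congrArg constantCoeff hG
    rw [constantCoeff_pdeOp, h0, Derivation.map_one_eq_zero, sub_zero] at h1
    rw [map_sub, h1]
    simp only [map_mul, map_add, map_sub, map_pow, h0, PowerSeries.constantCoeff_C, map_one]
    ring

/-- If `G(0) = H(0) = 1`, `M G = t y G` and `M H = t H`, then `H / G` is the exponential of a series
on which `M` takes the constant value `t (1 - y)`. -/
theorem eq_expOf_mul_of_pdeOp_eq (r : ℕ) (hr : 2 ≤ r) (G H : PowerSeries Poly)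
    (hG : pdeOp r G = PowerSeries.C (t * y) * G) (hG0 : constantCoeff G = 1)
    (hH : pdeOp r H = PowerSeries.C t * H) (hH0 : constantCoeff H = 1) :
    H = expOf (PowerSeries.C (t * (1 - y)) * integral (G ^ (r - 2))) * G := by
  obtain ⟨s, rfl⟩ : ∃ s, r = s + 2 := ⟨r - 2, by omega⟩
  rw [Nat.add_sub_cancel]
  set A := PowerSeries.C (t * (1 - y)) * integral (G ^ s) with hAdef
  have hA0 : constantCoeff A = 0 := by rw [map_mul, constantCoeff_integral, mul_zero]
  have hA' : derivative Poly A = PowerSeries.C (t * (1 - y)) * G ^ s := by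
    rw [hAdef, Derivation.leibniz, derivative_integral, PowerSeries.derivative_C, smul_zero,
      add_zero, smul_eq_mul]
  have hGs : pdeOp (s + 2) (G ^ s) = PowerSeries.C (s * t * y) * G ^ s := by
    rw [Derivation.leibniz_pow, hG]
    cases s with
    | zero => simp
    | succ s =>
      simp only [Nat.add_sub_cancel, smul_eq_mul, nsmul_eq_mul, map_mul, map_natCast]
      ring
  have hMA : pdeOp (s + 2) A = PowerSeries.C (t * (1 - y)) := by
    apply PowerSeries.derivative.ext
    · rw [derivative_pdeOp, hA', Derivation.leibniz, hGs, pdeOp_C, PowerSeries.derivative_C]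
      simp only [Derivation.leibniz, map_add, map_sub, polyDeriv_t, polyDeriv_y,
        Derivation.map_one_eq_zero, smul_eq_mul, map_mul, map_one, map_natCast, map_zero]
      push_cast
      ring
    · rw [constantCoeff_pdeOp, hA0, map_zero, sub_zero, hA']
      simp [hG0]
  rw [← sub_eq_zero]
  apply eq_zero_of_pdeOp_eq (s + 2) t
  · rw [map_sub, hH, Derivation.leibniz, hG, pdeOp_expOf _ _ _ hA0 hMA]
    simp only [smul_eq_mul, map_mul, map_sub, map_one]
    ring
  · rw [map_sub, map_mul, hH0, hG0, constantCoeff_expOf A hA0, mul_one, sub_self]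

/-- The case `r = 2` of the differential equation, rewritten for `H = e^{a x} G`
with `a = t (1 - y)`. -/
theorem derivative_expOf_mul_eq (G : PowerSeries Poly)
    (hG : derivative Poly G =
      (PowerSeries.C (t * (y - 1)) + G * (G - 1 + PowerSeries.C t)) * G) :
    derivative Poly (expOf (PowerSeries.C (t * (1 - y)) * PowerSeries.X) * G) =
      expOf (PowerSeries.C (t * (y - 1)) * PowerSeries.X) *
        (expOf (PowerSeries.C (t * (y - 1)) * PowerSeries.X) *
            (expOf (PowerSeries.C (t * (1 - y)) * PowerSeries.X) * G) - 1 + PowerSeries.C t) *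
        (expOf (PowerSeries.C (t * (1 - y)) * PowerSeries.X) * G) ^ 2 := by
  have h0 : constantCoeff (PowerSeries.C (t * (1 - y)) * PowerSeries.X) = 0 := by simp
  have hneg : PowerSeries.C (t * (y - 1)) * PowerSeries.X =
      -(PowerSeries.C (t * (1 - y)) * PowerSeries.X) := by
    rw [← neg_mul, ← map_neg]; congr 2; ring
  have hinv := expOf_mul_expOf_neg _ h0
  rw [← hneg] at hinv
  rw [Derivation.leibniz, derivative_expOf _ h0, hG, Derivation.leibniz, PowerSeries.derivative_X,
    PowerSeries.derivative_C]
  simp only [smul_eq_mul]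
  set Y := expOf (PowerSeries.C (t * (1 - y)) * PowerSeries.X)
  set Z := expOf (PowerSeries.C (t * (y - 1)) * PowerSeries.X)
  have e1 : Z * (Y * G) = G := by rw [← mul_assoc, mul_comm Z, hinv, one_mul]
  have e2 : Z * (G - 1 + PowerSeries.C t) * (Y * G) ^ 2 =
      (G - 1 + PowerSeries.C t) * G * (Y * G) := by
    linear_combination (G - 1 + PowerSeries.C t) * (Y * G) * e1
  rw [e1, e2]
  simp only [map_mul, map_sub, map_one]
  ring

end

/-! ### Clusters as permutations of `ℕ` -/

/-- The permutation of `ℕ` that extends a permutation of `Fin n` by the identity. -/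
def extend {n : ℕ} : Equiv.Perm (Fin n) ↪ Equiv.Perm ℕ where
  toFun π := (Equiv.Perm.subtypeEquivSubtypePerm (fun p : ℕ => p < n)
    (Fin.equivSubtype.permCongr π)).1
  inj' := fun _ _ h => Fin.equivSubtype.permCongr.injective
    ((Equiv.Perm.subtypeEquivSubtypePerm fun p : ℕ => p < n).injective (Subtype.ext h))

theorem extend_of_lt {n : ℕ} (π : Equiv.Perm (Fin n)) {p : ℕ} (h : p < n) :
    extend π p = π ⟨p, h⟩ := by
  change (Equiv.Perm.subtypeEquivSubtypePerm (fun p : ℕ => p < n)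
    (Fin.equivSubtype.permCongr π)).1 p = _
  exact Equiv.Perm.subtypeEquivSubtypePerm_apply_of_mem (p := fun p => p < n) _ h

theorem extend_of_le {n : ℕ} (π : Equiv.Perm (Fin n)) {p : ℕ} (h : n ≤ p) : extend π p = p := by
  change (Equiv.Perm.subtypeEquivSubtypePerm (fun p : ℕ => p < n)
    (Fin.equivSubtype.permCongr π)).1 p = _
  exact Equiv.Perm.subtypeEquivSubtypePerm_apply_of_not_mem (p := fun p => p < n) _ (not_lt.2 h)

theorem extend_inv {n : ℕ} (π : Equiv.Perm (Fin n)) : extend π⁻¹ = (extend π)⁻¹ := by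
  rw [eq_inv_iff_mul_eq_one]
  ext p
  rw [Equiv.Perm.mul_apply, Equiv.Perm.one_apply]
  rcases lt_or_ge p n with h | h
  · rw [extend_of_lt π h, extend_of_lt _ (Fin.is_lt _)]
    simp
  · rw [extend_of_le π h, extend_of_le _ h]

theorem exists_extend_eq {n : ℕ} {τ : Equiv.Perm ℕ} (h : ∀ p, n ≤ p → τ p = p) :
    ∃ π : Equiv.Perm (Fin n), extend π = τ := by
  refine ⟨Fin.equivSubtype.permCongr.symm
    ((Equiv.Perm.subtypeEquivSubtypePerm fun p : ℕ => p < n).symm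
      ⟨τ, fun p hp => h p (not_lt.1 hp)⟩), ?_⟩
  change (Equiv.Perm.subtypeEquivSubtypePerm (fun p : ℕ => p < n)
    (Fin.equivSubtype.permCongr _)).1 = τ
  rw [Equiv.apply_symm_apply, Equiv.apply_symm_apply]

/-- The letters of the word `2 1 3 4 ⋯`, indexed by `ℕ`. -/
def patternNat (a : ℕ) : ℕ := if a = 0 then 2 else if a = 1 then 1 else a + 1

theorem card_patternNat_le {m : ℕ} (hm : 2 ≤ m) (a : Fin m) :
    (Finset.univ.filter fun b : Fin m => patternNat b ≤ patternNat a).card = patternNat a := by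
  have h1 : ∀ b, 1 ≤ patternNat b := fun b => by unfold patternNat; split_ifs <;> omega
  have h2 : ∀ b : Fin m, patternNat b ≤ m := fun b => by
    have := b.2
    unfold patternNat; split_ifs <;> omega
  have hinj : Function.Injective patternNat := fun b c h => by
    unfold patternNat at h; split_ifs at h <;> omega
  have himg : (Finset.univ.filter fun b : Fin m => patternNat b ≤ patternNat a).image
      (fun b : Fin m => patternNat b) = Finset.Icc 1 (patternNat a) := by
    ext v
    simp only [Finset.mem_image, Finset.mem_filter, Finset.mem_univ, true_and, Finset.mem_Icc]
    constructor
    · rintro ⟨b, hb, rfl⟩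
      exact ⟨h1 b, hb⟩
    · rintro ⟨hv1, hv2⟩
      have hvm := hv2.trans (h2 a)
      obtain ⟨b, hb, rfl⟩ : ∃ b, b < m ∧ patternNat b = v := by
        by_cases e1 : v = 1
        · exact ⟨1, by omega, by simp [patternNat, e1]⟩
        by_cases e2 : v = 2
        · exact ⟨0, by omega, by simp [patternNat, e2]⟩
        refine ⟨v - 1, by omega, ?_⟩
        rw [patternNat, if_neg (by omega), if_neg (by omega)]
        omega
      exact ⟨⟨b, hb⟩, hv2, rfl⟩
  rw [← Finset.card_image_of_injective _
    (show Function.Injective fun b : Fin m => patternNat b from fun b c h => Fin.ext (hinj h)),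
    himg, Nat.card_Icc, Nat.add_sub_cancel]

/-- A word has standardization `2 1 3 ⋯ m` exactly if it is ordered like
this pattern. -/
theorem std_eq_pattern_iff {m n : ℕ} (hm : 2 ≤ m) (w : Fin m → Fin n) :
    std w = pattern m ↔ ∀ a b : Fin m, patternNat a < patternNat b → w a < w b := by
  have hpat : ∀ a, pattern m a = patternNat a := fun a => rfl
  constructor
  · intro h a b hab
    by_contra hlt
    have h1 : std w b ≤ std w a := Finset.card_le_card fun c hc => by
      simp only [Finset.mem_filter, Finset.mem_univ, true_and] at hc ⊢
      exact hc.trans (not_lt.1 hlt)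
    rw [h, hpat, hpat] at h1
    omega
  · intro h
    ext a
    rw [hpat, ← card_patternNat_le hm a, std]
    congr 1
    ext b
    simp only [Finset.mem_filter, Finset.mem_univ, true_and]
    constructor
    · intro hle
      by_contra hlt
      exact absurd (h a b (not_le.1 hlt)) (not_lt.2 hle)
    · intro hle
      rcases hle.lt_or_eq with hlt | heq
      · exact (h b a hlt).le
      · have hba : b = a := Fin.ext (by
          unfold patternNat at heq; split_ifs at heq <;> omega)
        rw [hba]

/-- The permutation `σ` of `ℕ` fixes all letters above `r k`, and its windows of `r + 1` letters
that start at `r j`, for `j < k`, are ordered like `2 1 3 ⋯ (r + 1)`. -/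
def IsNatCluster (r k : ℕ) (σ : Equiv.Perm ℕ) : Prop :=
  (∀ p, r * k + 1 ≤ p → σ p = p) ∧
    ∀ j < k, ∀ a b, a ≤ r → b ≤ r → patternNat a < patternNat b → σ (r * j + a) < σ (r * j + b)

theorem isNatCluster_extend_iff {r k : ℕ} (hr : 1 ≤ r) (σ : Equiv.Perm (Fin (r * k + 1))) :
    IsNatCluster r k (extend σ) ↔ IsCluster r k σ := by
  have hval : ∀ (j : Fin k) (a : Fin (r + 1)),
      extend σ (r * j + a) = σ ⟨r * j.val + a.val, window_lt j a⟩ :=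
    fun j a => extend_of_lt σ (window_lt j a)
  constructor
  · intro h j
    rw [std_eq_pattern_iff (by omega) _]
    intro a b hab
    have := h.2 j j.2 a b (by omega) (by omega) hab
    rw [hval, hval] at this
    exact this
  · intro h
    refine ⟨fun p hp => extend_of_le σ hp, fun j hj a b ha hb hab => ?_⟩
    have := (std_eq_pattern_iff (by omega) _).1 (h ⟨j, hj⟩)
      ⟨a, by omega⟩ ⟨b, by omega⟩ hab
    have h1 := hval ⟨j, hj⟩ ⟨a, by omega⟩
    have h2 := hval ⟨j, hj⟩ ⟨b, by omega⟩
    simp only at h1 h2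
    rw [h1, h2]
    exact this

/-- The set `P r k`, with its permutations extended to `ℕ`. -/
def natP (r k : ℕ) : Finset (Equiv.Perm ℕ) := (P r k).map extend

theorem mem_natP {r k : ℕ} (hr : 1 ≤ r) {π : Equiv.Perm ℕ} :
    π ∈ natP r k ↔ IsNatCluster r k π⁻¹ := by
  simp only [natP, Finset.mem_map, P, Finset.mem_filter, Finset.mem_univ, true_and]
  constructor
  · rintro ⟨ρ, hρ, rfl⟩
    rw [← extend_inv]
    exact (isNatCluster_extend_iff hr _).2 hρ
  · intro h
    obtain ⟨ρ, hρ⟩ := exists_extend_eq h.1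
    refine ⟨ρ⁻¹, ?_, ?_⟩
    · rw [inv_inv, ← isNatCluster_extend_iff hr, hρ]
      exact h
    · rw [extend_inv, hρ, inv_inv]

/-! ### Insertion of the letter `r k + 1` -/

/-- The cycle `i ↦ N + 1 ↦ N ↦ ⋯ ↦ i + 1 ↦ i` of `ℕ`. For a word `π` that fixes the letters above
`N`, the word `π * insertPerm N i` arises by inserting `N + 1` at the position `i`. -/
def insertPerm (N : ℕ) (i : Fin (N + 1)) : Equiv.Perm ℕ where
  toFun p := if p < i then p else if p = i then N + 1 else if p ≤ N + 1 then p - 1 else p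
  invFun q := if q < i then q else if q ≤ N then q + 1 else if q = N + 1 then i else q
  left_inv p := by have := i.2; dsimp only; split_ifs <;> omega
  right_inv q := by have := i.2; dsimp only; split_ifs <;> omega

theorem insertPerm_apply (N : ℕ) (i : Fin (N + 1)) (p : ℕ) :
    insertPerm N i p =
      if p < i then p else if p = i then N + 1 else if p ≤ N + 1 then p - 1 else p := rfl

theorem insertPerm_inv_apply (N : ℕ) (i : Fin (N + 1)) (q : ℕ) :
    (insertPerm N i)⁻¹ q =
      if q < i then q else if q ≤ N then q + 1 else if q = N + 1 then (i : ℕ) else q := rfl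

theorem apply_le_of_fix {N : ℕ} {σ : Equiv.Perm ℕ} (h : ∀ p, N < p → σ p = p) {p : ℕ}
    (hp : p ≤ N) : σ p ≤ N := by
  by_contra hlt
  have h1 := h _ (not_le.1 hlt)
  have h2 := σ.injective h1
  omega

/-- In a cluster the letter at the position `r k` is the largest one. -/
theorem apply_le_apply_last_of_windows {r k : ℕ} (hr : 2 ≤ r) {σ : Equiv.Perm ℕ}
    (h : ∀ j < k, ∀ a b, a ≤ r → b ≤ r → patternNat a < patternNat b →
      σ (r * j + a) < σ (r * j + b)) {p : ℕ} (hp : p ≤ r * k) : σ p ≤ σ (r * k) := by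
  induction k with
  | zero => rw [show p = r * 0 by omega]
  | succ k ih =>
    have hk : r * (k + 1) = r * k + r := by ring
    have hlast : ∀ a, a ≤ r → σ (r * k + a) ≤ σ (r * k + r) := by
      intro a ha
      rcases ha.lt_or_eq with hlt | rfl
      · refine (h k (by omega) a r ha le_rfl ?_).le
        unfold patternNat
        split_ifs <;> omega
      · exact le_rfl
    rw [hk]
    rcases le_or_gt p (r * k) with hle | hgt
    · exact (ih (fun j hj => h j (by omega)) hle).trans (hlast 0 (by omega))
    · obtain ⟨a, rfl⟩ := Nat.exists_eq_add_of_le hgt.le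
      exact hlast a (by omega)

/-- A permutation of `ℕ` that maps smaller letters to smaller values and larger letters to larger
values than `m` fixes `m`. -/
theorem apply_eq_of_lt_iff {σ : Equiv.Perm ℕ} {m : ℕ} (h : ∀ p, p < m ↔ σ p < σ m) :
    σ m = m := by
  have himg : (Finset.range m).map σ.toEmbedding = Finset.range (σ m) := by
    ext v
    simp only [Finset.mem_map, Finset.mem_range, Equiv.coe_toEmbedding]
    constructor
    · rintro ⟨p, hp, rfl⟩
      exact (h p).1 hp
    · intro hv
      exact ⟨σ.symm v, (h _).2 (by rwa [Equiv.apply_symm_apply]), Equiv.apply_symm_apply _ _⟩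
  have := congrArg Finset.card himg
  rwa [Finset.card_map, Finset.card_range, Finset.card_range, eq_comm] at this

/-- In a cluster all letters from `r k + 2` on are fixed: they are preceded by smaller and followed
by larger letters only. -/
theorem IsNatCluster.apply_eq {r k : ℕ} (hr : 2 ≤ r) {σ : Equiv.Perm ℕ}
    (h : IsNatCluster r (k + 1) σ) {m : ℕ} (hm : r * k + 2 ≤ m) : σ m = m := by
  have hk : r * (k + 1) = r * k + r := by ring
  rcases lt_or_ge (r * k + r) m with hgt | hle
  · exact h.1 m (by omega)
  have hfix : ∀ p, r * k + r < p → σ p = p := fun p hp => h.1 p (by omega)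
  have hwin := h.2 k (by omega)
  have hstep : ∀ a b, 2 ≤ b → b ≤ r → a < b → σ (r * k + a) < σ (r * k + b) := by
    intro a b hb hbr hab
    refine hwin a b (by omega) hbr ?_
    unfold patternNat
    split_ifs <;> omega
  -- the position `r k` already holds the maximum of the letters up to `r k`
  have hlow : ∀ p m, r * k + 2 ≤ m → m ≤ r * k + r → p < m → σ p < σ m := by
    intro p m hm hmr hpm
    obtain ⟨b, rfl⟩ := Nat.exists_eq_add_of_le (show r * k ≤ m by omega)
    rcases le_or_gt p (r * k) with hle | hgt
    · exact (apply_le_apply_last_of_windows hr (fun j hj => h.2 j (by omega)) hle).trans_lt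
        (hstep 0 b (by omega) (by omega) (by omega))
    · obtain ⟨a, rfl⟩ := Nat.exists_eq_add_of_le hgt.le
      exact hstep a b (by omega) (by omega) (by omega)
  apply apply_eq_of_lt_iff
  intro p
  refine ⟨hlow p m hm hle, fun hlt => ?_⟩
  by_contra hp
  rcases (not_lt.1 hp).lt_or_eq with hgt | rfl
  · rcases le_or_gt p (r * k + r) with hpr | hpr
    · have := hlow m p (by omega) hpr hgt
      omega
    · have := apply_le_of_fix hfix hle
      rw [hfix p hpr] at hlt
      omega
  · omega

theorem isNatCluster_insertPerm_mul {r k : ℕ} (hr : 2 ≤ r) {σ : Equiv.Perm ℕ}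
    (h : IsNatCluster r k σ) (i : Fin (r * k + 1)) :
    IsNatCluster r (k + 1) ((insertPerm (r * k) i)⁻¹ * σ) := by
  have hk : r * (k + 1) = r * k + r := by ring
  have hi := i.2
  have hfix : ∀ p, r * k < p → σ p = p := fun p hp => h.1 p hp
  refine ⟨fun p hp => ?_, fun j hj a b ha hb hab => ?_⟩
  · rw [Equiv.Perm.mul_apply, hfix p (by omega), insertPerm_inv_apply]
    split_ifs <;> omega
  · rw [Equiv.Perm.mul_apply, Equiv.Perm.mul_apply]
    rcases (Nat.lt_succ_iff.1 hj).lt_or_eq with hjk | rfl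
    · have hlt := h.2 j hjk a b ha hb hab
      have hjk' : r * (j + 1) ≤ r * k := Nat.mul_le_mul_left r hjk
      rw [Nat.mul_add, Nat.mul_one] at hjk'
      have h1 := apply_le_of_fix hfix (show r * j + a ≤ r * k by omega)
      have h2 := apply_le_of_fix hfix (show r * j + b ≤ r * k by omega)
      rw [insertPerm_inv_apply, insertPerm_inv_apply]
      split_ifs <;> omega
    · -- the last window: its first letter was the maximum, its second letter is the new one
      have hmax : σ (r * j) = r * j := by
        refine le_antisymm (apply_le_of_fix hfix le_rfl) ?_
        have h1 := apply_le_apply_last_of_windows hr h.2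
          (apply_le_of_fix (σ := σ⁻¹) (N := r * j) (fun p hp => by
            rw [Equiv.Perm.inv_eq_iff_eq, hfix p hp]) le_rfl)
        rwa [show σ (σ⁻¹ (r * j)) = r * j from σ.apply_symm_apply _] at h1
      have hval : ∀ a, a ≤ r → (insertPerm (r * j) i)⁻¹ (σ (r * j + a)) =
          if a = 0 then r * j + 1 else if a = 1 then (i : ℕ) else r * j + a := by
        intro a ha
        rw [insertPerm_inv_apply]
        rcases Nat.eq_zero_or_pos a with rfl | hpos
        · rw [add_zero, hmax]
          split_ifs <;> omega
        · rw [hfix _ (by omega)]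
          split_ifs <;> omega
      rw [hval a ha, hval b hb]
      unfold patternNat at hab
      split_ifs at hab ⊢ <;> omega

theorem exists_insertPerm_mul {r k : ℕ} (hr : 2 ≤ r) {σ : Equiv.Perm ℕ}
    (h : IsNatCluster r (k + 1) σ) :
    ∃ i : Fin (r * k + 1), IsNatCluster r k (insertPerm (r * k) i * σ) := by
  have hk : r * (k + 1) = r * k + r := by ring
  have hfix : ∀ p, r * k + 1 < p → σ p = p := fun p hp => h.apply_eq hr hp
  have hi : σ (r * k + 1) < r * k + 1 := by
    have h1 := h.2 k (by omega) 1 0 (by omega) (by omega) (by simp [patternNat])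
    have h2 := apply_le_of_fix hfix (show r * k + 0 ≤ r * k + 1 by omega)
    omega
  refine ⟨⟨σ (r * k + 1), hi⟩, fun p hp => ?_, fun j hj a b ha hb hab => ?_⟩
  · rw [Equiv.Perm.mul_apply, insertPerm_apply]
    rcases hp.lt_or_eq with hlt | rfl
    · rw [hfix p hlt]
      dsimp only
      split_ifs <;> omega
    · simp
  · have hlt := h.2 j (by omega) a b ha hb hab
    have hjk : r * (j + 1) ≤ r * k := Nat.mul_le_mul_left r hj
    rw [Nat.mul_add, Nat.mul_one] at hjk
    have h1 := apply_le_of_fix hfix (show r * j + a ≤ r * k + 1 by omega)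
    have h2 := apply_le_of_fix hfix (show r * j + b ≤ r * k + 1 by omega)
    have h3 : σ (r * j + a) ≠ σ (r * k + 1) := fun e => by
      have := σ.injective e; omega
    have h4 : σ (r * j + b) ≠ σ (r * k + 1) := fun e => by
      have := σ.injective e; omega
    rw [Equiv.Perm.mul_apply, Equiv.Perm.mul_apply, insertPerm_apply, insertPerm_apply]
    dsimp only
    split_ifs <;> omega

/-- Every element of `P r (k + 1)` arises in a unique way from an element of `P r k` by inserting
the letter `r k + 1` somewhere before its end and appending `r k + 2, …, r k + r`. -/
theorem sum_natP_succ {r k : ℕ} (hr : 2 ≤ r) (f : Equiv.Perm ℕ → Poly) :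
    ∑ π ∈ natP r (k + 1), f π =
      ∑ π ∈ natP r k, ∑ i : Fin (r * k + 1), f (π * insertPerm (r * k) i) := by
  rw [← Finset.sum_product']
  symm
  refine Finset.sum_nbij (fun x => x.1 * insertPerm (r * k) x.2) ?_ ?_ ?_ fun _ _ => rfl
  · rintro ⟨π, i⟩ hx
    have hπ := (mem_natP (by omega)).1 (Finset.mem_product.1 hx).1
    rw [mem_natP (by omega), mul_inv_rev]
    exact isNatCluster_insertPerm_mul hr hπ i
  · rintro ⟨π, i⟩ hx ⟨π', i'⟩ hx' heq
    have hπ := ((mem_natP (by omega)).1 (Finset.mem_product.1 hx).1).1 (r * k + 1) le_rfl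
    have hπ' := ((mem_natP (by omega)).1 (Finset.mem_product.1 hx').1).1 (r * k + 1) le_rfl
    dsimp only at heq hπ hπ'
    -- both words carry the letter `r k + 1` at the position of insertion
    have hinv := congrArg (fun ρ : Equiv.Perm ℕ => ρ⁻¹ (r * k + 1)) heq
    have hval : ∀ i : Fin (r * k + 1), (insertPerm (r * k) i)⁻¹ (r * k + 1) = i := fun i => by
      have := i.2
      rw [insertPerm_inv_apply]
      split_ifs <;> omega
    simp only [mul_inv_rev, Equiv.Perm.mul_apply, hπ, hπ', hval] at hinv
    obtain rfl : i = i' := Fin.ext hinv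
    rw [mul_right_cancel heq]
  · intro ρ hρ
    have hρ' := (mem_natP (by omega)).1 (Finset.mem_coe.1 hρ)
    obtain ⟨i, hi⟩ := exists_insertPerm_mul hr hρ'
    refine ⟨(ρ * (insertPerm (r * k) i)⁻¹, i), ?_, ?_⟩
    · simp only [Finset.mem_coe, Finset.mem_product, Finset.mem_univ, and_true]
      rw [mem_natP (by omega), mul_inv_rev, inv_inv]
      exact hi
    · simp

/-! ### The recurrence for the two families of polynomials -/

/-- Beyond the last letter of a word that is extended by the identity there are no descents. -/
theorem descInd_eq_zero_of_fix {N : ℕ} {π : Equiv.Perm ℕ} (h : ∀ p, N < p → π p = p) {p : ℕ}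
    (hp : N ≤ p) : descInd π p = 0 := by
  rw [descInd, if_neg]
  rw [h (p + 1) (by omega)]
  rcases hp.lt_or_eq with hlt | rfl
  · rw [h p hlt]; omega
  · have := apply_le_of_fix h (le_refl N)
    omega

theorem wt_eq_of_fix (b : Prop) {N L : ℕ} (hNL : N ≤ L) {π : Equiv.Perm ℕ}
    (h : ∀ p, N < p → π p = p) : wt b L π = wt b N π := by
  obtain ⟨l, rfl⟩ := Nat.exists_eq_add_of_le hNL
  have h0 : ∀ p, descInd π (N + p) = 0 := fun p => descInd_eq_zero_of_fix h (by omega)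
  rw [wt, wt, Finset.sum_range_add, Finset.sum_range_add,
    Finset.sum_eq_zero (s := Finset.range l) fun p _ => h0 p,
    Finset.sum_eq_zero (s := Finset.range l) fun p _ => peakInd_eq_zero_of_descInd (h0 p),
    add_zero, add_zero]

theorem wt_congr (b : Prop) {N : ℕ} {f g : ℕ → ℕ} (h : ∀ p ≤ N, f p = g p) :
    wt b N f = wt b N g := by
  have h1 : ∀ p ∈ Finset.range N, descInd f p = descInd g p := fun p hp => by
    have := Finset.mem_range.1 hp
    rw [descInd, descInd, h p (by omega), h (p + 1) (by omega)]
  have h2 : ∀ p ∈ Finset.range N, peakInd b f p = peakInd b g p := fun p hp => by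
    have := Finset.mem_range.1 hp
    rw [peakInd, peakInd, h p (by omega), h (p + 1) (by omega), h (p - 1) (by omega)]
  rw [wt, wt, Finset.sum_congr rfl h1, Finset.sum_congr rfl h2]

theorem wt_mul_insertPerm (b : Prop) {N L : ℕ} (hNL : N + 1 ≤ L) {π : Equiv.Perm ℕ}
    (h : ∀ p, N < p → π p = p) (i : Fin (N + 1)) :
    wt b L ⇑(π * insertPerm N i) = wt b (N + 1) (insertAt i (N + 1) π) := by
  have hi := i.2
  rw [wt_eq_of_fix b hNL fun p hp => ?_]
  · refine wt_congr b fun p hp => ?_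
    rw [Equiv.Perm.mul_apply, insertPerm_apply, insertAt]
    split_ifs with h1 h2
    · rfl
    · exact h _ (by omega)
    · rfl
  · rw [Equiv.Perm.mul_apply, insertPerm_apply, if_neg (by omega), if_neg (by omega),
      if_neg (by omega), h p (by omega)]

open Classical in
theorem sum_wt_natP_succ (b : Prop) {r k : ℕ} (hr : 2 ≤ r) :
    ∑ π ∈ natP r (k + 1), wt b (r * (k + 1)) π =
      polyDeriv (∑ π ∈ natP r k, wt b (r * k) π) +
        ((if b then t * y else t) + r * t * y * k) * ∑ π ∈ natP r k, wt b (r * k) π := by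
  rw [sum_natP_succ hr, map_sum, Finset.mul_sum, ← Finset.sum_add_distrib]
  refine Finset.sum_congr rfl fun π hπ => ?_
  have hfix' := ((mem_natP (by omega)).1 hπ).1
  have hfix : ∀ p, r * k < p → π p = p := fun p hp => by
    have := hfix' p hp
    rw [Equiv.Perm.inv_eq_iff_eq] at this
    exact this.symm
  have hk : r * k + 1 ≤ r * (k + 1) := by rw [Nat.mul_add]; omega
  rw [Finset.sum_congr rfl fun i _ => wt_mul_insertPerm b hk hfix i,
    Fin.sum_univ_eq_sum_range (fun i => wt b (r * k + 1) (insertAt i (r * k + 1) π)),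
    sum_wt_insertAt b (fun p hp => Nat.lt_succ_of_le (apply_le_of_fix hfix hp))
      (descInd_eq_zero_of_fix hfix le_rfl)]
  rw [wt, polyDeriv_monomial]
  push_cast
  ring

theorem isDescent_iff {N : ℕ} (π : Equiv.Perm (Fin (N + 1))) (i : Fin (N + 1)) :
    IsDescent π i ↔ extend π (i + 1) < extend π i := by
  rw [extend_of_lt π i.2]
  constructor
  · rintro ⟨h, hlt⟩
    rw [extend_of_lt π h]
    exact hlt
  · intro hlt
    have h : i.val + 1 < N + 1 := by
      by_contra hge
      rw [extend_of_le π (by omega)] at hlt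
      have := (π ⟨i, i.2⟩).2
      omega
    rw [extend_of_lt π h] at hlt
    exact ⟨h, hlt⟩

theorem isPeak_iff {N : ℕ} (π : Equiv.Perm (Fin (N + 1))) (i : Fin (N + 1)) :
    IsPeak π i ↔ extend π (i + 1) < extend π i ∧ 0 < i.val ∧
      extend π (i - 1) < extend π i := by
  rw [IsPeak, isDescent_iff, extend_of_lt π i.2,
    extend_of_lt π (lt_of_le_of_lt (Nat.sub_le _ _) i.isLt), ← Fin.lt_def]
  tauto

theorem des_eq {N : ℕ} (π : Equiv.Perm (Fin (N + 1))) :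
    des π = ∑ p ∈ Finset.range (N + 1), descInd (extend π) p := by
  classical
  rw [des, Finset.card_filter, ← Fin.sum_univ_eq_sum_range]
  refine Finset.sum_congr rfl fun i _ => ?_
  rw [descInd]
  exact if_congr (isDescent_iff π i) rfl rfl

theorem pk_eq {N : ℕ} (π : Equiv.Perm (Fin (N + 1))) :
    pk π = ∑ p ∈ Finset.range (N + 1), peakInd False (extend π) p := by
  classical
  rw [pk, Finset.card_filter, ← Fin.sum_univ_eq_sum_range]
  refine Finset.sum_congr rfl fun i _ => ?_
  have key : IsPeak π i ↔ extend π (i + 1) < extend π i ∧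
      ((i.val = 0 ∧ False) ∨ (0 < i.val ∧ extend π (i - 1) < extend π i)) := by
    rw [isPeak_iff]
    tauto
  by_cases h : IsPeak π i
  · rw [if_pos h, peakInd, if_pos (key.1 h)]
  · rw [if_neg h, peakInd, if_neg fun h' => h (key.2 h')]

theorem lpk_eq {N : ℕ} (π : Equiv.Perm (Fin (N + 1))) :
    lpk π = ∑ p ∈ Finset.range (N + 1), peakInd True (extend π) p := by
  classical
  rw [lpk, Finset.card_filter, ← Fin.sum_univ_eq_sum_range]
  refine Finset.sum_congr rfl fun i _ => ?_
  have key : IsLeftPeak π i ↔ extend π (i + 1) < extend π i ∧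
      ((i.val = 0 ∧ True) ∨ (0 < i.val ∧ extend π (i - 1) < extend π i)) := by
    rw [IsLeftPeak, isPeak_iff, isDescent_iff]
    tauto
  by_cases h : IsLeftPeak π i
  · rw [if_pos h, peakInd, if_pos (key.1 h)]
  · rw [if_neg h, peakInd, if_neg fun h' => h (key.2 h')]

theorem wt_extend (b : Prop) {N : ℕ} (π : Equiv.Perm (Fin (N + 1))) :
    wt b (N + 1) (extend π) = wt b N (extend π) :=
  wt_eq_of_fix b (Nat.le_succ N) fun _ hp => extend_of_le π hp

theorem polyC_eq (r k : ℕ) : polyC r k = ∑ π ∈ natP r k, wt False (r * k) π := by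
  rw [polyC, natP, Finset.sum_map]
  refine Finset.sum_congr rfl fun π _ => ?_
  rw [← wt_extend, wt, des_eq, pk_eq]

theorem polyCtilde_eq (r k : ℕ) : polyCtilde r k = ∑ π ∈ natP r k, wt True (r * k) π := by
  rw [polyCtilde, natP, Finset.sum_map]
  refine Finset.sum_congr rfl fun π _ => ?_
  rw [← wt_extend, wt, des_eq, lpk_eq]

theorem sum_wt_natP_zero (b : Prop) (r : ℕ) : ∑ π ∈ natP r 0, wt b (r * 0) π = 1 := by
  have h : P r 0 = Finset.univ := by
    ext π
    simp [P, IsCluster]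
  simp [natP, h, wt]

theorem pdeOp_F {r : ℕ} (hr : 2 ≤ r) : pdeOp r (F r) = PowerSeries.C t * F r := by
  refine pdeOp_egf r t _ ?_ fun k => ?_
  · rw [polyC_eq, sum_wt_natP_zero]
  · rw [polyC_eq, polyC_eq, sum_wt_natP_succ False hr, if_neg not_false]

theorem pdeOp_Ftilde {r : ℕ} (hr : 2 ≤ r) :
    pdeOp r (Ftilde r) = PowerSeries.C (t * y) * Ftilde r := by
  refine pdeOp_egf r (t * y) _ ?_ fun k => ?_
  · rw [polyCtilde_eq, sum_wt_natP_zero]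
  · rw [polyCtilde_eq, polyCtilde_eq, sum_wt_natP_succ True hr, if_pos trivial]

end InverseClusters

theorem mainTheorem4 :
    (∀ r : ℕ, 2 ≤ r →
      PowerSeries.derivative InverseClusters.Poly (InverseClusters.Ftilde r) =
          (PowerSeries.C (InverseClusters.t * (InverseClusters.y - 1)) +
            InverseClusters.Ftilde r *
              (InverseClusters.Ftilde r - 1 + PowerSeries.C InverseClusters.t)) *
            InverseClusters.Ftilde r ^ (r - 1) ∧
        PowerSeries.constantCoeff (InverseClusters.Ftilde r) = 1 ∧
        InverseClusters.F r =
          InverseClusters.expOf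
              (PowerSeries.C (InverseClusters.t * (1 - InverseClusters.y)) *
                InverseClusters.integral (InverseClusters.Ftilde r ^ (r - 2))) *
            InverseClusters.Ftilde r) ∧
    InverseClusters.F 2 =
      InverseClusters.expOf
          (PowerSeries.C (InverseClusters.t * (1 - InverseClusters.y)) * PowerSeries.X) *
        InverseClusters.Ftilde 2 ∧
    PowerSeries.derivative InverseClusters.Poly (InverseClusters.F 2) =
      InverseClusters.expOf
          (PowerSeries.C (InverseClusters.t * (InverseClusters.y - 1)) * PowerSeries.X) *
        (InverseClusters.expOf
              (PowerSeries.C (InverseClusters.t * (InverseClusters.y - 1)) * PowerSeries.X) *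
            InverseClusters.F 2 - 1 + PowerSeries.C InverseClusters.t) *
        InverseClusters.F 2 ^ 2 ∧
    PowerSeries.constantCoeff (InverseClusters.F 2) = 1 := by
  have hG : ∀ r, 2 ≤ r → _ := fun r hr =>
    InverseClusters.derivative_eq_of_pdeOp_eq r hr _ (InverseClusters.pdeOp_Ftilde hr)
      (InverseClusters.constantCoeff_egf _)
  have hF : ∀ r, 2 ≤ r → _ := fun r hr =>
    InverseClusters.eq_expOf_mul_of_pdeOp_eq r hr _ _ (InverseClusters.pdeOp_Ftilde hr)
      (InverseClusters.constantCoeff_egf _) (InverseClusters.pdeOp_F hr)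
      (InverseClusters.constantCoeff_egf _)
  have h2 := hF 2 le_rfl
  rw [Nat.sub_self, pow_zero, InverseClusters.integral_one] at h2
  refine ⟨fun r hr => ⟨hG r hr, InverseClusters.constantCoeff_egf _, hF r hr⟩, h2, ?_,
    InverseClusters.constantCoeff_egf _⟩
  have h3 := hG 2 le_rfl
  rw [show 2 - 1 = 1 from rfl, pow_one] at h3
  rw [h2]
  exact InverseClusters.derivative_expOf_mul_eq _ h3
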